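/- All Banach spaces are real, and operators and isomorphisms between them are linear and bounded (isomorphisms with bounded inverse). For a set $I$ let $\ell_\infty(I)$ be the space of bounded functions $f:I\to\mathbb{R}$ with the supremum norm and $c_0(I)$ its closed subspace of those $f$ for which $\{i\in I:|f(i)|\ge\varepsilon\}$ is finite for every $\varepsilon>0$; write $c_0(\omega_1)$ for $c_0(I)$ when $I$ has cardinality $\omega_1$ (the first uncountable cardinal), and $\ell_\infty/c_0=\ell_\infty(\mathbb{N})/c_0(\mathbb{N})$ with the quotient norm. For Banach spaces $X,Y$: - $X$ is $Y$-extensible if for every subspace $Z\subseteq X$ isomorphic to $Y$, every operator $T:Z\to X$ extends to an operator $\tilde T:X\to X$; - $X$ is $Y$-automorphic if for all subspaces $Z,Z'\subseteq X$ isomorphic to $Y$ such that $X/Z$ and $X/Z'$ have the same density (least cardinality of a dense subset), every isomorphism from $Z$ onto $Z'$ extends to an isomorphism of $X$ onto $X$. Let $\mathfrak{a}$ be the smallest infinite cardinality of a maximal (under inclusion) family of infinite subsets of $\mathbb{N}$ whose pairwise intersections are finite. **Theorem 1.1.** If $\mathfrak{a}=\omega_1$, then $\ell_\infty/c_0$ is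 not $c_0(\omega_1)$-automorphic and not $c_0(\omega_1)$-extensible. -/

import Mathlib

open Filter Topology Cardinal

noncomputable section

/-- The real Banach space `ℓ_∞(ι)` of bounded real functions on `ι` with the supremum norm. -/
abbrev LInfty (ι : Type) : Type := lp (fun _ : ι => ℝ) ⊤

/-- The space `c₀(ι)`, as a subspace of `ℓ_∞(ι)`: the functions `f` such that
`{i | ε ≤ |f i|}` is finite for every `ε > 0`. It carries the supremum norm. -/
def czero (ι : Type) : Submodule ℝ (LInfty ι) where
  carrier := {f | Tendsto (fun i => f i) cofinite (𝓝 0)}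
  zero_mem' := by
    simpa using (tendsto_const_nhds : Tendsto (fun _ : ι => (0 : ℝ)) cofinite (𝓝 0))
  add_mem' := by
    intro f g hf hg
    simpa using Tendsto.add hf hg
  smul_mem' := by
    intro c f hf
    simpa using Tendsto.const_mul c hf

theorem mem_czero {ι : Type} {f : LInfty ι} :
    f ∈ czero ι ↔ Tendsto (fun i => f i) cofinite (𝓝 0) := Iff.rfl

instance czero_isClosed (ι : Type) : IsClosed (czero ι : Set (LInfty ι)) := by
  refine isClosed_of_closure_subset fun f hf => ?_
  show Tendsto (fun i => f i) cofinite (𝓝 0)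
  rw [Metric.tendsto_nhds]
  intro ε hε
  obtain ⟨g, hg, hfg⟩ := Metric.mem_closure_iff.1 hf (ε / 2) (half_pos hε)
  have hg' : Tendsto (fun i => g i) cofinite (𝓝 0) := hg
  filter_upwards [Metric.tendsto_nhds.1 hg' (ε / 2) (half_pos hε)] with i hi
  have h1 : ‖(f - g) i‖ ≤ ‖f - g‖ := lp.norm_apply_le_norm ENNReal.top_ne_zero (f - g) i
  have h2 : dist (f i) (g i) ≤ dist f g := by
    rw [dist_eq_norm, dist_eq_norm]
    simpa using h1
  linarith [dist_triangle (f i) (g i) 0]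

instance czero_completeSpace (ι : Type) : CompleteSpace (czero ι) :=
  (czero_isClosed ι).completeSpace_coe

/-- The Banach space `ℓ_∞/c₀` with the quotient norm. -/
abbrev LInftyModCzero : Type := LInfty ℕ ⧸ czero ℕ

/-- The density of a topological space: the least cardinality of a dense subset. -/
def topDensity (X : Type) [TopologicalSpace X] : Cardinal.{0} :=
  sInf {κ | ∃ s : Set X, Dense s ∧ #s = κ}

/-- `X` is `Y`-extensible: for every subspace `Z` of `X` isomorphic to `Y`, every bounded linear
operator `Z → X` extends to a bounded linear operator `X → X`. (A subspace `Z` isomorphic to the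
Banach space `Y` is automatically closed in `X`.) -/
def IsExtensibleFor (Y X : Type) [NormedAddCommGroup Y] [NormedSpace ℝ Y] [CompleteSpace Y]
    [NormedAddCommGroup X] [NormedSpace ℝ X] [CompleteSpace X] : Prop :=
  ∀ Z : Submodule ℝ X, Nonempty (Z ≃L[ℝ] Y) →
    ∀ T : Z →L[ℝ] X, ∃ S : X →L[ℝ] X, ∀ z : Z, S z = T z

/-- `X` is `Y`-automorphic: whenever `Z, Z'` are subspaces of `X` isomorphic to `Y` and of the same
codimension, in the sense that `X/Z` and `X/Z'` have the same density, every isomorphism from `Z`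
onto `Z'` extends to an automorphism of `X`. -/
def IsAutomorphicFor (Y X : Type) [NormedAddCommGroup Y] [NormedSpace ℝ Y] [CompleteSpace Y]
    [NormedAddCommGroup X] [NormedSpace ℝ X] [CompleteSpace X] : Prop :=
  ∀ Z Z' : Submodule ℝ X, Nonempty (Z ≃L[ℝ] Y) → Nonempty (Z' ≃L[ℝ] Y) →
    topDensity (X ⧸ Z) = topDensity (X ⧸ Z') →
    ∀ T : Z ≃L[ℝ] Z', ∃ S : X ≃L[ℝ] X, ∀ z : Z, S z = (T z : X)

/-- A family of infinite subsets of `ℕ` whose pairwise intersections are finite. -/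
def IsAlmostDisjoint (A : Set (Set ℕ)) : Prop :=
  (∀ a ∈ A, a.Infinite) ∧ ∀ a ∈ A, ∀ b ∈ A, a ≠ b → (a ∩ b).Finite

/-- The cardinal `𝔞`: the least infinite cardinality of an almost disjoint family that is maximal
with respect to inclusion. -/
def almostDisjointnessNumber : Cardinal.{0} :=
  sInf {κ | ∃ A : Set (Set ℕ), A.Infinite ∧ Maximal IsAlmostDisjoint A ∧ #A = κ}

end

/-!
Write `X = ℓ_∞/c₀` and `[s] ∈ X` for the class of the indicator function of `s ⊆ ℕ`. An almost
disjoint family `F` spans an isometric copy of `c₀` in `X` (`czeroEmbedding`), whose unit vectors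
are the classes `[F i]`. Both assertions follow from one such family of size `ω₁`, together with a
permutation of it that is not induced by any bounded operator on `X`
(`exists_family_permutation`): the subspace spanned by the family is invariant under the
permutation, so that no question about the densities of the quotients arises.

The family consists of two halves, which the permutation interchanges: a maximal almost disjoint
family `A` of size `ω₁`, given by `𝔞 = ω₁`, and an almost disjoint family `B` of size `ω₁` of the
opposite character, existing without any hypothesis, in which every countable subfamily is almost
covered by a set `D` that has infinite intersection with only countably many members.

Suppose that an operator `S` maps `[B i]` to `[A i]` for all `i` (`not_exists_operator`). Let
`i 0, i 1, …` be distinct indices and let `φ m` be the limit along a free ultrafilter containing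
`A (i m)`. Choose disjoint sets `G n` almost equal to `B (i n)`. For each `m` the set function
`J ↦ φ m (S [⋃ n ∈ J, G n])` is bounded and finitely additive, and its values on points are those of
the Dirac measure at `m`; hence it agrees with this Dirac measure on all but countably many members
of an uncountable almost disjoint family (`countable_ne_zero_of_additive`). So there is an infinite
`J` such that `S [⋃ n ∈ J, G n]` takes the value `1` at all the points `φ m`, `m ∈ J`. Since `A` is
maximal, a set that meets infinitely many members of `A` in infinite sets meets uncountably many of
them so (`not_countable_infinite_inter`); among these there are new indices for which the sets `B i`
are almost disjoint from the union just used, and the construction can be repeated inside the part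
of `ℕ` on which the previous images are large. After `k` repetitions there is a set `C` with
`‖S [C]‖ ≥ k / 2`, although `‖[C]‖ ≤ 1`. For large `k` this is absurd.
-/

noncomputable section

/-! ### Indicator classes and evaluation at free ultrafilters -/

/-- The indicator function of `s ⊆ ℕ`, as an element of `ℓ_∞(ℕ)`. -/
def indLInfty (s : Set ℕ) : LInfty ℕ :=
  ⟨s.indicator 1, memℓp_infty ⟨1, by
    rintro _ ⟨n, rfl⟩
    by_cases h : n ∈ s <;> simp [h]⟩⟩

/-- The class of the indicator function of `s ⊆ ℕ` in `ℓ_∞/c₀`. It depends on `s` only up to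
finite sets. -/
def indClass (s : Set ℕ) : LInftyModCzero := (czero ℕ).mkQ (indLInfty s)

theorem indLInfty_apply (s : Set ℕ) (n : ℕ) : indLInfty s n = s.indicator 1 n := rfl

theorem mkQ_eq_of_eventuallyEq {f g : LInfty ℕ} (h : ∀ᶠ n in cofinite, f n = g n) :
    (czero ℕ).mkQ f = (czero ℕ).mkQ g := by
  rw [Submodule.mkQ_apply, Submodule.mkQ_apply, Submodule.Quotient.eq, mem_czero]
  refine tendsto_const_nhds.congr' (h.mono fun n hn => ?_)
  simp [hn]

theorem norm_mkQ_le_of_eventually {f : LInfty ℕ} {r : ℝ} (hr : 0 ≤ r)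
    (h : ∀ᶠ n in cofinite, |f n| ≤ r) : ‖(czero ℕ).mkQ f‖ ≤ r := by
  have hb : ∀ n, ‖Set.indicator {n | |f n| ≤ r} (fun n => f n) n‖ ≤ r := by
    intro n
    by_cases hn : |f n| ≤ r
    · simp [Set.indicator, hn]
    · simpa [Set.indicator, hn] using hr
  let g : LInfty ℕ := ⟨Set.indicator {n | |f n| ≤ r} (fun n => f n),
    memℓp_infty ⟨r, by rintro _ ⟨n, rfl⟩; exact hb n⟩⟩
  have hg : (czero ℕ).mkQ f = (czero ℕ).mkQ g := by
    refine mkQ_eq_of_eventuallyEq (h.mono fun n hn => ?_)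
    exact (Set.indicator_of_mem (s := {n | |f n| ≤ r}) hn (fun n => f n)).symm
  rw [hg]
  refine (Submodule.Quotient.norm_mk_le _ g).trans ?_
  exact lp.norm_le_of_forall_le hr hb

theorem indClass_union {s t : Set ℕ} (h : Disjoint s t) :
    indClass (s ∪ t) = indClass s + indClass t := by
  rw [indClass, indClass, indClass, ← map_add]
  congr 1
  ext n
  simp only [lp.coeFn_add, Pi.add_apply, indLInfty_apply]
  rw [Set.indicator_union_of_disjoint h]

theorem norm_indClass_le (s : Set ℕ) : ‖indClass s‖ ≤ 1 := by
  refine norm_mkQ_le_of_eventually zero_le_one (Eventually.of_forall fun n => ?_)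
  by_cases h : n ∈ s <;> simp [indLInfty_apply, h]

theorem indClass_congr {s t : Set ℕ} (h₁ : (s \ t).Finite) (h₂ : (t \ s).Finite) :
    indClass s = indClass t := by
  refine mkQ_eq_of_eventuallyEq ?_
  filter_upwards [h₁.compl_mem_cofinite, h₂.compl_mem_cofinite] with n hn₁ hn₂
  by_cases hs : n ∈ s <;> by_cases ht : n ∈ t <;> simp_all [indLInfty_apply]

/-- Evaluation at a point of `ℕ* = βℕ \ ℕ`: the limit along a free ultrafilter is a functional of
norm at most one on `ℓ_∞/c₀`. -/
theorem exists_functional_tendsto (U : Ultrafilter ℕ) (hU : (U : Filter ℕ) ≤ cofinite) :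
    ∃ φ : LInftyModCzero →L[ℝ] ℝ, (∀ x, |φ x| ≤ ‖x‖) ∧
      ∀ f : LInfty ℕ, Tendsto (fun n => f n) U (𝓝 (φ ((czero ℕ).mkQ f))) := by
  have hb : ∀ (f : LInfty ℕ) n, |f n| ≤ ‖f‖ := fun f n =>
    lp.norm_apply_le_norm ENNReal.top_ne_zero f n
  have hex : ∀ f : LInfty ℕ, ∃ a : ℝ, Tendsto (fun n => f n) U (𝓝 a) := by
    intro f
    obtain ⟨a, -, ha⟩ := (isCompact_Icc (a := -‖f‖) (b := ‖f‖)).ultrafilter_le_nhds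
      (U.map fun n => f n) (by
        rw [le_principal_iff]
        exact Filter.mem_map.2 (Filter.univ_mem' fun n => abs_le.1 (hb f n)))
    exact ⟨a, ha⟩
  choose L hL using hex
  let l : LInfty ℕ →ₗ[ℝ] ℝ :=
    { toFun := L
      map_add' := fun f g => tendsto_nhds_unique (hL (f + g)) (by simpa using (hL f).add (hL g))
      map_smul' := fun c f => tendsto_nhds_unique (hL (c • f))
        (by simpa using (hL f).const_mul c) }
  have hk : czero ℕ ≤ LinearMap.ker l := fun f hf =>
    tendsto_nhds_unique (hL f) ((mem_czero.1 hf).mono_left hU)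
  have hlb : ∀ f, |L f| ≤ ‖f‖ := fun f =>
    le_of_tendsto (hL f).abs (Eventually.of_forall (hb f))
  have hq : ∀ x : LInftyModCzero, ‖(czero ℕ).liftQ l hk x‖ ≤ 1 * ‖x‖ := by
    intro x
    rw [one_mul]
    refine le_of_forall_pos_le_add fun ε hε => ?_
    obtain ⟨f, rfl, hf⟩ := Submodule.Quotient.norm_mk_lt x hε
    exact (hlb f).trans hf.le
  refine ⟨LinearMap.mkContinuous _ 1 hq, fun x => ?_, fun f => hL f⟩
  simpa using hq x

theorem map_indClass_eq_one {φ : LInftyModCzero →L[ℝ] ℝ} {U : Ultrafilter ℕ}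
    (hφ : ∀ f : LInfty ℕ, Tendsto (fun n => f n) U (𝓝 (φ ((czero ℕ).mkQ f)))) {s : Set ℕ}
    (hs : s ∈ U) : φ (indClass s) = 1 := by
  refine tendsto_nhds_unique (hφ (indLInfty s)) (tendsto_const_nhds.congr' ?_)
  filter_upwards [hs] with n hn
  simp [indLInfty_apply, hn]

theorem map_indClass_eq_zero {φ : LInftyModCzero →L[ℝ] ℝ} {U : Ultrafilter ℕ}
    (hφ : ∀ f : LInfty ℕ, Tendsto (fun n => f n) U (𝓝 (φ ((czero ℕ).mkQ f)))) {s : Set ℕ}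
    (hs : s ∉ U) : φ (indClass s) = 0 := by
  refine tendsto_nhds_unique (hφ (indLInfty s)) (tendsto_const_nhds.congr' ?_)
  filter_upwards [Ultrafilter.compl_mem_iff_notMem.2 hs] with n hn
  simp [indLInfty_apply, Set.indicator_of_notMem hn]

theorem exists_free_ultrafilter {M : Set ℕ} (hM : M.Infinite) :
    ∃ U : Ultrafilter ℕ, (U : Filter ℕ) ≤ cofinite ∧ M ∈ U := by
  have := hM.cofinite_inf_principal_neBot
  refine ⟨Ultrafilter.of (cofinite ⊓ 𝓟 M), (Ultrafilter.of_le _).trans inf_le_left, ?_⟩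
  exact (Ultrafilter.of_le _).trans inf_le_right (mem_principal_self M)

theorem infinite_of_mem_free_ultrafilter {U : Ultrafilter ℕ} (hU : (U : Filter ℕ) ≤ cofinite)
    {s : Set ℕ} (hs : s ∈ U) : s.Infinite := fun hf =>
  Ultrafilter.compl_notMem_iff.2 hs (hU hf.compl_mem_cofinite)

instance t2Space_lInftyModCzero : T2Space LInftyModCzero :=
  have h : ∀ (E : Type) [NormedAddCommGroup E], T2Space E := fun _ _ => inferInstance
  h _

/-! ### Copies of `c₀(ι)` spanned by almost disjoint families -/

section Embedding

variable {ι : Type} {F : ι → Set ℕ}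

theorem norm_sum_smul_indClass_le (hF : ∀ i j, i ≠ j → (F i ∩ F j).Finite) (s : Finset ι)
    (c : ι → ℝ) {r : ℝ} (hr : 0 ≤ r) (hc : ∀ i ∈ s, |c i| ≤ r) :
    ‖∑ i ∈ s, c i • indClass (F i)‖ ≤ r := by
  have h : ∑ i ∈ s, c i • indClass (F i) = (czero ℕ).mkQ (∑ i ∈ s, c i • indLInfty (F i)) := by
    simp [indClass]
  rw [h]
  refine norm_mkQ_le_of_eventually hr ?_
  have hfin : (⋃ i ∈ s, ⋃ j ∈ s, ⋃ _ : i ≠ j, F i ∩ F j).Finite :=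
    s.finite_toSet.biUnion fun i _ => s.finite_toSet.biUnion fun j _ =>
      Set.finite_iUnion fun hij => hF i j hij
  filter_upwards [hfin.compl_mem_cofinite] with n hn
  have hval : (∑ i ∈ s, c i • indLInfty (F i)) n = ∑ i ∈ s, c i * (F i).indicator 1 n := by
    rw [lp.coeFn_sum, Finset.sum_apply]
    rfl
  rw [hval]
  by_cases hex : ∃ i ∈ s, n ∈ F i
  · obtain ⟨i, his, hni⟩ := hex
    rw [Finset.sum_eq_single_of_mem i his]
    · simpa [hni] using hc i his
    · intro j hjs hji
      have : n ∉ F j := fun hnj => hn (by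
        simp only [Set.mem_iUnion]
        exact ⟨i, his, j, hjs, hji.symm, hni, hnj⟩)
      simp [this]
  · push Not at hex
    rw [Finset.sum_eq_zero fun i hi => by simp [hex i hi]]
    simpa using hr

theorem summable_smul_indClass (hF : ∀ i j, i ≠ j → (F i ∩ F j).Finite) (f : czero ι) :
    Summable fun i => (f : LInfty ι) i • indClass (F i) := by
  rw [summable_iff_vanishing_norm]
  intro ε hε
  have hf : {i | ¬ |(f : LInfty ι) i| < ε / 2}.Finite := by
    have := Metric.tendsto_nhds.1 (mem_czero.1 f.2) (ε / 2) (half_pos hε)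
    simpa using this
  refine ⟨hf.toFinset, fun t ht => ?_⟩
  refine (norm_sum_smul_indClass_le hF t _ (half_pos hε).le fun i hi => ?_).trans_lt
    (half_lt_self hε)
  by_contra hcon
  exact Finset.disjoint_left.1 ht hi (by simpa using le_of_not_ge hcon)

/-- The isometric copy of `c₀(ι)` in `ℓ_∞/c₀` spanned by the classes of the indicator functions of
an almost disjoint family: the unit vectors of `c₀(ι)` go to these classes. -/
def czeroEmbedding (F : ι → Set ℕ) (hinf : ∀ i, (F i).Infinite)
    (hF : ∀ i j, i ≠ j → (F i ∩ F j).Finite) : czero ι →ₗᵢ[ℝ] LInftyModCzero where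
  toFun f := ∑' i, (f : LInfty ι) i • indClass (F i)
  map_add' f g := by
    rw [← (summable_smul_indClass hF f).tsum_add (summable_smul_indClass hF g)]
    exact tsum_congr fun i => by simp [add_smul]
  map_smul' c f := by
    rw [RingHom.id_apply, ← (summable_smul_indClass hF f).tsum_const_smul c]
    exact tsum_congr fun i => by simp [mul_smul]
  norm_map' f := by
    change ‖∑' i, (f : LInfty ι) i • indClass (F i)‖ = ‖(f : LInfty ι)‖
    have hs := summable_smul_indClass hF f
    refine le_antisymm ?_ ?_
    · refine le_of_tendsto hs.hasSum.norm (Eventually.of_forall fun s => ?_)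
      exact norm_sum_smul_indClass_le hF s _ (norm_nonneg _) fun i _ =>
        lp.norm_apply_le_norm ENNReal.top_ne_zero (f : LInfty ι) i
    · -- A free ultrafilter containing `F i` evaluates the sum to `f i`.
      refine lp.norm_le_of_forall_le (norm_nonneg _) fun i => ?_
      obtain ⟨U, hU, hiU⟩ := exists_free_ultrafilter (hinf i)
      obtain ⟨φ, hφ, hφt⟩ := exists_functional_tendsto U hU
      have hval : φ (∑' j, (f : LInfty ι) j • indClass (F j)) = (f : LInfty ι) i := by
        rw [φ.map_tsum hs, tsum_eq_single i]
        · simp [map_indClass_eq_one hφt hiU]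
        · intro j hj
          have : F j ∉ U := fun hjU =>
            infinite_of_mem_free_ultrafilter hU (inter_mem hjU hiU) (hF j i hj)
          simp [map_indClass_eq_zero hφt this]
      rw [Real.norm_eq_abs, ← hval]
      exact hφ _

theorem czeroEmbedding_apply (hinf : ∀ i, (F i).Infinite)
    (hF : ∀ i j, i ≠ j → (F i ∩ F j).Finite) (f : czero ι) :
    czeroEmbedding F hinf hF f = ∑' i, (f : LInfty ι) i • indClass (F i) := rfl

theorem exists_czeroEmbedding_eq_indClass (i : ι) :
    ∃ f : czero ι, ∀ (F : ι → Set ℕ) (hinf : ∀ i, (F i).Infinite)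
      (hF : ∀ i j, i ≠ j → (F i ∩ F j).Finite),
        czeroEmbedding F hinf hF f = indClass (F i) := by
  classical
  let g : LInfty ι := lp.single (E := fun _ : ι => ℝ) ⊤ i 1
  have hg : ∀ j, j ≠ i → g j = 0 := fun j hj => lp.single_apply_ne (p := ⊤) (E := fun _ : ι => ℝ) i 1 hj
  have hgi : g i = 1 := lp.single_apply_self (p := ⊤) (E := fun _ : ι => ℝ) i 1
  refine ⟨⟨g, mem_czero.2 (tendsto_const_nhds.congr' ?_)⟩, fun F hinf hF => ?_⟩
  · filter_upwards [(Set.finite_singleton i).compl_mem_cofinite] with j hj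
    exact (hg j hj).symm
  · rw [czeroEmbedding_apply, tsum_eq_single i]
    · simp [hgi]
    · intro j hj
      simp [hg j hj]

theorem range_czeroEmbedding_comp_le (hinf : ∀ i, (F i).Infinite)
    (hF : ∀ i j, i ≠ j → (F i ∩ F j).Finite) (σ : Equiv.Perm ι)
    (hinf' : ∀ i, ((F ∘ σ) i).Infinite)
    (hF' : ∀ i j, i ≠ j → ((F ∘ σ) i ∩ (F ∘ σ) j).Finite) :
    LinearMap.range (czeroEmbedding (F ∘ σ) hinf' hF').toLinearMap ≤
      LinearMap.range (czeroEmbedding F hinf hF).toLinearMap := by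
  rintro _ ⟨f, rfl⟩
  let g : LInfty ι := ⟨fun i => (f : LInfty ι) (σ.symm i), memℓp_infty ⟨‖(f : LInfty ι)‖, by
    rintro _ ⟨i, rfl⟩
    exact lp.norm_apply_le_norm ENNReal.top_ne_zero (f : LInfty ι) _⟩⟩
  have hg : g ∈ czero ι := (mem_czero.1 f.2).comp σ.symm.injective.tendsto_cofinite
  refine ⟨⟨g, hg⟩, ?_⟩
  change ∑' i, (f : LInfty ι) (σ.symm i) • indClass (F i) =
    ∑' i, (f : LInfty ι) i • indClass (F (σ i))
  rw [← σ.tsum_eq]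
  simp

theorem range_czeroEmbedding_comp (hinf : ∀ i, (F i).Infinite)
    (hF : ∀ i j, i ≠ j → (F i ∩ F j).Finite) (σ : Equiv.Perm ι)
    (hinf' : ∀ i, ((F ∘ σ) i).Infinite)
    (hF' : ∀ i j, i ≠ j → ((F ∘ σ) i ∩ (F ∘ σ) j).Finite) :
    LinearMap.range (czeroEmbedding (F ∘ σ) hinf' hF').toLinearMap =
      LinearMap.range (czeroEmbedding F hinf hF).toLinearMap := by
  refine le_antisymm (range_czeroEmbedding_comp_le hinf hF σ hinf' hF') ?_
  have hσ : (F ∘ σ) ∘ σ.symm = F := by ext; simp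
  have := range_czeroEmbedding_comp_le hinf' hF' σ.symm (by rwa [hσ]) (by rwa [hσ])
  simpa only [hσ] using this

end Embedding

/-! ### Combinatorics of almost disjoint families -/

/-- A set that meets infinitely many members of a maximal almost disjoint family in infinite sets so
meets uncountably many: otherwise it has an infinite subset almost disjoint from all of these, which
contradicts maximality. Maximality is required only inside `⋃ i, A i`, so that the lemma applies to
a copy of a maximal family inside an infinite proper subset of `ℕ`. -/
theorem not_countable_infinite_inter {ι : Type} {A : ι → Set ℕ}
    (hA : ∀ i j, i ≠ j → (A i ∩ A j).Finite)
    (hmax : ∀ M : Set ℕ, M.Infinite → M ⊆ ⋃ i, A i → ∃ i, (M ∩ A i).Infinite)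
    {E : Set ℕ} (hE : {i | (A i ∩ E).Infinite}.Infinite) :
    ¬ {i | (A i ∩ E).Infinite}.Countable := by
  intro hc
  have : Infinite {i | (A i ∩ E).Infinite} := hE.to_subtype
  have : Countable {i | (A i ∩ E).Infinite} := hc
  obtain ⟨e⟩ := nonempty_equiv_of_countable (α := ℕ) (β := {i | (A i ∩ E).Infinite})
  have hstep : ∀ n N : ℕ, ∃ m, N ≤ m ∧ m ∈ A (e n) ∩ E ∧ ∀ k < n, m ∉ A (e k) := by
    intro n N
    have hfin : (Set.Iio N ∪ ⋃ k ∈ Set.Iio n, A (e n) ∩ A (e k)).Finite :=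
      (Set.finite_Iio N).union <| (Set.finite_Iio n).biUnion fun k hk =>
        hA _ _ fun h => hk.ne' (e.injective (Subtype.ext h))
    obtain ⟨m, hm, hm'⟩ := ((e n).2.sdiff hfin).nonempty
    simp only [Set.mem_union, Set.mem_Iio, Set.mem_iUnion, not_or, not_lt, not_exists] at hm'
    exact ⟨m, hm'.1, hm, fun k hk hmk => hm'.2 k hk ⟨hm.1, hmk⟩⟩
  choose m hm₁ hm₂ hm₃ using hstep
  let x : ℕ → ℕ := fun n => Nat.rec (m 0 0) (fun n y => m (n + 1) (y + 1)) n
  have hx : ∀ n, ∃ N, x n = m n N := by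
    rintro (_ | n)
    exacts [⟨_, rfl⟩, ⟨_, rfl⟩]
  have hmono : StrictMono x := strictMono_nat_of_lt_succ fun n => hm₁ (n + 1) (x n + 1)
  have hxA : ∀ n, x n ∈ A (e n) ∩ E := fun n => by
    obtain ⟨N, hN⟩ := hx n
    rw [hN]
    exact hm₂ n N
  obtain ⟨i, hi⟩ := hmax (Set.range x) (Set.infinite_range_of_injective hmono.injective)
    (by rintro _ ⟨n, rfl⟩; exact Set.mem_iUnion.2 ⟨_, (hxA n).1⟩)
  have hiE : (A i ∩ E).Infinite := hi.mono (by
    rintro _ ⟨⟨n, rfl⟩, h⟩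
    exact ⟨h, (hxA n).2⟩)
  obtain ⟨k, hk⟩ := e.surjective ⟨i, hiE⟩
  refine hi (((Set.finite_Iic k).image x).subset ?_)
  rintro _ ⟨⟨n, rfl⟩, h⟩
  refine ⟨n, ?_, rfl⟩
  by_contra hn
  obtain ⟨N, hN⟩ := hx n
  refine hm₃ n N k (not_le.1 hn) ?_
  rw [hk, ← hN]
  exact h

/-- A bounded finitely additive set function vanishing on points is zero on all but countably many
members of an almost disjoint family, because finitely many members are disjoint after removal of
finite sets. -/
theorem countable_ne_zero_of_additive {ι : Type} {F : ι → Set ℕ}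
    (hF : ∀ i j, i ≠ j → (F i ∩ F j).Finite) {ν : Set ℕ → ℝ} {K : ℝ}
    (hadd : ∀ s t, Disjoint s t → ν (s ∪ t) = ν s + ν t) (hbd : ∀ s, |ν s| ≤ K)
    (hpt : ∀ n, ν {n} = 0) : {i | ν (F i) ≠ 0}.Countable := by
  classical
  have h0 : ν ∅ = 0 := by simpa using hadd ∅ ∅ (Set.disjoint_empty _)
  have hfin : ∀ s : Set ℕ, s.Finite → ν s = 0 := by
    intro s hs
    induction s, hs using Set.Finite.induction_on with
    | empty => exact h0
    | @insert a s ha _ ih =>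
      rw [Set.insert_eq, hadd _ _ (Set.disjoint_singleton_left.2 ha), hpt, ih, add_zero]
  have hsum : ∀ (G : ι → Set ℕ) (s : Finset ι), (∀ i ∈ s, ∀ j ∈ s, i ≠ j → Disjoint (G i) (G j)) →
      ν (⋃ i ∈ s, G i) = ∑ i ∈ s, ν (G i) := by
    intro G s
    induction s using Finset.induction_on with
    | empty => intro _; simpa using h0
    | insert a s ha ih =>
      intro hG
      rw [Finset.set_biUnion_insert, Finset.sum_insert ha, hadd, ih]
      · exact fun i hi j hj => hG i (Finset.mem_insert_of_mem hi) j (Finset.mem_insert_of_mem hj)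
      · refine Set.disjoint_iUnion₂_right.2 fun i hi => ?_
        exact hG a (Finset.mem_insert_self _ _) i (Finset.mem_insert_of_mem hi)
          fun h => ha (h ▸ hi)
  have hF_sum : ∀ s : Finset ι, |∑ i ∈ s, ν (F i)| ≤ K := by
    intro s
    set P : Set ℕ := ⋃ i ∈ s, ⋃ j ∈ s, ⋃ _ : i ≠ j, F i ∩ F j with hP
    have hPfin : P.Finite := s.finite_toSet.biUnion fun i _ => s.finite_toSet.biUnion fun j _ =>
      Set.finite_iUnion fun hij => hF i j hij
    have hdiff : ∀ i, ν (F i) = ν (F i \ P) := by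
      intro i
      conv_lhs => rw [← Set.sdiff_union_inter (F i) P]
      rw [hadd _ _ Set.disjoint_sdiff_inter, hfin _ (hPfin.subset Set.inter_subset_right),
        add_zero]
    rw [Finset.sum_congr rfl fun i _ => hdiff i, ← hsum]
    · exact hbd _
    · intro i hi j hj hij
      refine Set.disjoint_left.2 fun n hni hnj => hni.2 ?_
      simp only [hP, Set.mem_iUnion]
      exact ⟨i, hi, j, hj, hij, hni.1, hnj.1⟩
  have hle : ∀ s : Finset ι, ∑ i ∈ s, |ν (F i)| ≤ K + K := by
    intro s
    rw [← Finset.sum_filter_add_sum_filter_not s (fun i => 0 ≤ ν (F i))]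
    refine add_le_add ?_ ?_
    · rw [Finset.sum_congr rfl fun i hi => abs_of_nonneg (Finset.mem_filter.1 hi).2]
      exact (le_abs_self _).trans (hF_sum _)
    · rw [Finset.sum_congr rfl fun i hi =>
        abs_of_neg (not_le.1 (Finset.mem_filter.1 hi).2), Finset.sum_neg_distrib]
      exact (neg_le_abs _).trans (hF_sum _)
  have hsm : Summable fun i => |ν (F i)| := summable_of_sum_le (fun i => abs_nonneg _) hle
  simpa [Function.support] using hsm.countable_support

/-- Countably many functions `ℕ → ℕ` are eventually dominated by one function. -/
theorem exists_eventually_gt {T : Set (ℕ → ℕ)} (hT : T.Countable) :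
    ∃ g : ℕ → ℕ, ∀ f ∈ T, ∀ᶠ n in atTop, f n < g n := by
  rcases T.eq_empty_or_nonempty with rfl | hne
  · exact ⟨0, by simp⟩
  obtain ⟨u, rfl⟩ := hT.exists_eq_range hne
  refine ⟨fun n => (∑ k ∈ Finset.range (n + 1), u k n) + 1, ?_⟩
  rintro _ ⟨k, rfl⟩
  filter_upwards [eventually_ge_atTop k] with n hn
  exact Nat.lt_succ_of_le (Finset.single_le_sum (f := fun k => u k n) (fun _ _ => Nat.zero_le _)
    (Finset.mem_range.2 (Nat.lt_succ_of_le hn)))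

/-- An almost disjoint family of size `ω₁` each of whose countable subfamilies is almost covered by
a set having infinite intersection with only countably many members: the graphs of an
`ω₁`-sequence of functions that increases modulo finite sets. -/
theorem exists_countably_separated_family {ι : Type} (hι : #ι = ℵ_ 1) :
    ∃ B : ι → Set ℕ, (∀ i, (B i).Infinite) ∧ (∀ i j, i ≠ j → (B i ∩ B j).Finite) ∧
      ∀ J : Set ι, J.Countable →
        ∃ D : Set ℕ, (∀ j ∈ J, (B j \ D).Finite) ∧ {i | (B i ∩ D).Infinite}.Countable := by
  obtain ⟨r, hr, hord⟩ := Cardinal.exists_ord_eq ι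
  have hseg : ∀ i, {j | r j i}.Countable := by
    intro i
    have h1 : Ordinal.typein r i < (ℵ_ 1 : Cardinal.{0}).ord := by
      rw [← hι, hord]
      exact Ordinal.typein_lt_type r i
    have h2 : #{j | r j i} < ℵ_ 1 := Cardinal.lt_ord.1 h1
    rw [← Cardinal.le_aleph0_iff_set_countable]
    rw [← Cardinal.succ_aleph0] at h2
    exact Order.lt_succ_iff.1 h2
  let f : ι → ℕ → ℕ := (IsWellFounded.wf (r := r)).fix fun i g =>
    (exists_eventually_gt (T := Set.range fun j : {j | r j i} => g j.1 j.2)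
      (by have := (hseg i).to_subtype; exact Set.countable_range _)).choose
  have hf : ∀ i j, r j i → ∀ᶠ n in atTop, f j n < f i n := by
    intro i j hji
    have : f i = _ := (IsWellFounded.wf (r := r)).fix_eq _ i
    rw [this]
    exact (exists_eventually_gt (T := Set.range fun j : {j | r j i} => f j.1)
      (by have := (hseg i).to_subtype; exact Set.countable_range _)).choose_spec _
        ⟨⟨j, hji⟩, rfl⟩
  have hinj : ∀ i, Function.Injective fun n => Nat.pair n (f i n) := fun i a b hab =>
    (Nat.pair_eq_pair.1 hab).1
  have hlt : ∀ i j, r j i → {n | f i n ≤ f j n}.Finite := fun i j hji => by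
    have := hf i j hji
    rw [← Nat.cofinite_eq_atTop] at this
    simpa [eventually_cofinite] using this
  refine ⟨fun i => Set.range fun n => Nat.pair n (f i n),
    fun i => Set.infinite_range_of_injective (hinj i), ?_, ?_⟩
  · have key : ∀ i j, r j i → ((Set.range fun n => Nat.pair n (f i n)) ∩
        Set.range fun n => Nat.pair n (f j n)).Finite := by
      intro i j hji
      refine ((hlt i j hji).image fun n => Nat.pair n (f i n)).subset ?_
      rintro _ ⟨⟨n, rfl⟩, ⟨k, hk⟩⟩
      obtain ⟨rfl, h⟩ := Nat.pair_eq_pair.1 hk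
      exact ⟨k, h.ge, rfl⟩
    intro i j hij
    rcases trichotomous_of r i j with h | h | h
    · rw [Set.inter_comm]
      exact key j i h
    · exact absurd h hij
    · exact key i j h
  · intro J hJ
    -- The union of countably many initial segments is countable, so `J` has a strict upper bound.
    obtain ⟨a, ha⟩ : ∃ a, ∀ j ∈ J, r j a := by
      by_contra hcon
      push Not at hcon
      have hcov : (Set.univ : Set ι) ⊆ ⋃ j ∈ J, insert j {i | r i j} := by
        intro i _
        obtain ⟨j, hj, hji⟩ := hcon i
        refine Set.mem_biUnion hj ?_
        rcases trichotomous_of r i j with h | h | h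
        · exact Or.inr h
        · exact Or.inl h
        · exact absurd h hji
      have hcu : (Set.univ : Set ι).Countable :=
        (hJ.biUnion fun j _ => (hseg j).insert j).mono hcov
      have h1 : #ι ≤ ℵ₀ := by
        rw [← Cardinal.mk_univ]
        exact Cardinal.le_aleph0_iff_set_countable.2 hcu
      rw [hι] at h1
      exact absurd h1 (not_le.2 Cardinal.aleph0_lt_aleph_one)
    refine ⟨{x | x.unpair.2 < f a x.unpair.1}, fun j hj => ?_, (hseg a).mono fun i hi => ?_⟩
    · refine ((hlt a j (ha j hj)).image fun n => Nat.pair n (f j n)).subset ?_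
      rintro _ ⟨⟨n, rfl⟩, hn⟩
      exact ⟨n, by simpa using hn, rfl⟩
    · by_contra hia
      have hle : {n | f i n < f a n}.Finite := by
        rcases trichotomous_of r i a with h | rfl | h
        · exact absurd h hia
        · simp
        · exact (hlt i a h).subset fun n (hn : f i n < f a n) => hn.le
      refine hi ((hle.image fun n => Nat.pair n (f i n)).subset ?_)
      rintro _ ⟨⟨n, rfl⟩, hn⟩
      exact ⟨n, by simpa using hn, rfl⟩

/-- If `𝔞 = ω₁`, some maximal almost disjoint family is indexed by `ι`. -/
theorem exists_maximal_family {ι : Type} (h : almostDisjointnessNumber = ℵ_ 1) (hι : #ι = ℵ_ 1) :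
    ∃ A : ι → Set ℕ, (∀ i, (A i).Infinite) ∧ (∀ i j, i ≠ j → (A i ∩ A j).Finite) ∧
      ∀ M : Set ℕ, M.Infinite → ∃ i, (M ∩ A i).Infinite := by
  have hne : {κ : Cardinal.{0} | ∃ A : Set (Set ℕ),
      A.Infinite ∧ Maximal IsAlmostDisjoint A ∧ #A = κ}.Nonempty := by
    by_contra hcon
    rw [almostDisjointnessNumber, Set.not_nonempty_iff_eq_empty.1 hcon, Cardinal.sInf_empty] at h
    exact (Cardinal.aleph_pos 1).ne h
  obtain ⟨A, -, hmax, hcard⟩ := csInf_mem hne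
  change #A = almostDisjointnessNumber at hcard
  rw [h, ← hι] at hcard
  obtain ⟨e⟩ := Cardinal.eq.1 hcard.symm
  refine ⟨fun i => e i, fun i => hmax.prop.1 _ (e i).2, fun i j hij =>
    hmax.prop.2 _ (e i).2 _ (e j).2 fun h => hij (e.injective (Subtype.ext h)), fun M hM => ?_⟩
  by_contra hcon
  have hfin : ∀ a ∈ A, (M ∩ a).Finite := by
    intro a ha
    by_contra hinf
    exact hcon ⟨e.symm ⟨a, ha⟩, by simpa using hinf⟩
  have had : IsAlmostDisjoint (insert M A) := by
    refine ⟨?_, ?_⟩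
    · rintro a (rfl | ha)
      exacts [hM, hmax.prop.1 a ha]
    · rintro a (rfl | ha) b (rfl | hb) hab
      · exact absurd rfl hab
      · exact hfin b hb
      · rw [Set.inter_comm]
        exact hfin a ha
      · exact hmax.prop.2 a ha b hb hab
  have hMA : M ∈ A := hmax.le_of_ge had (Set.subset_insert M A) (Set.mem_insert M A)
  exact hM (by simpa using hfin M hMA)

/-! ### Operators from a countably separated family to a maximal one -/

section NoExtension

variable {ι : Type} {A B : ι → Set ℕ}

/-- The inductive step towards `not_exists_operator`: from `C` with `S 1_C ≥ r` near infinitely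
many `A i`, a set `C'` with `S 1_{C'} ≥ r + 1 / 2` near infinitely many `A i`. -/
theorem exists_set_operator_step [Uncountable ι]
    (hA : ∀ i j, i ≠ j → (A i ∩ A j).Finite)
    (hmax : ∀ M : Set ℕ, M.Infinite → M ⊆ ⋃ i, A i → ∃ i, (M ∩ A i).Infinite)
    (hAinf : ∀ i, (A i).Infinite)
    (hB : ∀ i j, i ≠ j → (B i ∩ B j).Finite)
    (hsep : ∀ J : Set ι, J.Countable →
      ∃ D : Set ℕ, (∀ j ∈ J, (B j \ D).Finite) ∧ {i | (B i ∩ D).Infinite}.Countable)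
    (S : LInftyModCzero →L[ℝ] LInftyModCzero) (hS : ∀ i, S (indClass (B i)) = indClass (A i))
    {C : Set ℕ} (hC : {i | (B i ∩ C).Infinite}.Countable) {f : LInfty ℕ} {r : ℝ}
    (hf : (czero ℕ).mkQ f = S (indClass C))
    (hfA : {i | (A i ∩ {n | r ≤ f n}).Infinite}.Infinite) :
    ∃ C' : Set ℕ, {i | (B i ∩ C').Infinite}.Countable ∧ ∃ f' : LInfty ℕ,
      (czero ℕ).mkQ f' = S (indClass C') ∧
        {i | (A i ∩ {n | r + 1 / 2 ≤ f' n}).Infinite}.Infinite := by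
  classical
  set E : Set ℕ := {n | r ≤ f n} with hE
  have hunc := not_countable_infinite_inter hA hmax hfA
  have hinf : ({i | (A i ∩ E).Infinite} \ {i | (B i ∩ C).Infinite}).Infinite := fun hfin =>
    hunc ((hC.union hfin.countable).mono fun i hi => by
      by_cases h : (B i ∩ C).Infinite
      exacts [Or.inl h, Or.inr ⟨hi, h⟩])
  obtain ⟨i, hi_inj, hi⟩ : ∃ i : ℕ → ι, Function.Injective i ∧
      ∀ n, (A (i n) ∩ E).Infinite ∧ (B (i n) ∩ C).Finite := by
    refine ⟨fun n => hinf.natEmbedding _ n, fun a b hab =>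
      (hinf.natEmbedding _).injective (Subtype.ext hab), fun n => ?_⟩
    have := (hinf.natEmbedding _ n).2
    exact ⟨this.1, Set.not_infinite.1 this.2⟩
  obtain ⟨D, hD, hDc⟩ := hsep (Set.range i) (Set.countable_range i)
  -- Disjoint modifications of the sets `B (i n)` inside `D \ C`.
  let G : ℕ → Set ℕ := fun n => ((B (i n) ∩ D) \ C) \ ⋃ m ∈ Set.Iio n, B (i m)
  have hGdisj : ∀ m n, m < n → Disjoint (G m) (G n) := fun m n hmn =>
    Set.disjoint_left.2 fun x hx hx' => hx'.2 (Set.mem_biUnion hmn hx.1.1.1)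
  have hGdisj' : ∀ m n, m ≠ n → Disjoint (G m) (G n) := fun m n hmn => by
    rcases lt_or_gt_of_ne hmn with h | h
    exacts [hGdisj m n h, (hGdisj n m h).symm]
  have hGB : ∀ n, indClass (G n) = indClass (B (i n)) := by
    intro n
    refine indClass_congr ?_ ?_
    · rw [Set.sdiff_eq_empty.2 fun x hx => hx.1.1.1]
      exact Set.finite_empty
    · refine ((hD _ ⟨n, rfl⟩).union ((hi n).2.union ((Set.finite_Iio n).biUnion fun m hm =>
        hB (i n) (i m) fun h => (ne_of_lt hm) (hi_inj h).symm))).subset ?_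
      rintro x ⟨hx, hx'⟩
      by_cases h₁ : x ∈ D
      · by_cases h₂ : x ∈ C
        · exact Or.inr (Or.inl ⟨hx, h₂⟩)
        · refine Or.inr (Or.inr ?_)
          by_contra h₃
          refine hx' ⟨⟨⟨hx, h₁⟩, h₂⟩, fun h₄ => h₃ ?_⟩
          simp only [Set.mem_iUnion] at h₄ ⊢
          obtain ⟨m, hm, hxm⟩ := h₄
          exact ⟨m, hm, hx, hxm⟩
      · exact Or.inl ⟨hx, h₁⟩
  let V : Set ℕ → Set ℕ := fun J => ⋃ n ∈ J, G n
  have hVadd : ∀ s t, Disjoint s t → indClass (V (s ∪ t)) = indClass (V s) + indClass (V t) := by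
    intro s t hst
    rw [← indClass_union]
    · simp only [V, Set.biUnion_union]
    · refine Set.disjoint_iUnion₂_left.2 fun m hm => Set.disjoint_iUnion₂_right.2 fun n hn =>
        hGdisj' m n ?_
      rintro rfl
      exact Set.disjoint_left.1 hst hm hn
  -- Points of `ℕ*` in the closures of the sets `A (i n) ∩ E`.
  choose U hU hUA using fun n => exists_free_ultrafilter (hi n).1
  choose φ hφ hφt using fun n => exists_functional_tendsto (U n) (hU n)
  have hφA : ∀ m n, φ m (indClass (A (i n))) = if m = n then 1 else 0 := by
    intro m n
    split_ifs with h
    · subst h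
      exact map_indClass_eq_one (hφt m) (mem_of_superset (hUA m) Set.inter_subset_left)
    · refine map_indClass_eq_zero (hφt m) fun hmem => ?_
      exact infinite_of_mem_free_ultrafilter (hU m) (inter_mem (hUA m) hmem)
        ((hA (i m) (i n) fun h' => h (hi_inj h')).subset
          (Set.inter_subset_inter_left _ Set.inter_subset_left))
  -- The defect of countable additivity of the `m`-th functional along the sets `G n`.
  let ν : ℕ → Set ℕ → ℝ := fun m J => φ m (S (indClass (V J))) - J.indicator 1 m
  have hνadd : ∀ m s t, Disjoint s t → ν m (s ∪ t) = ν m s + ν m t := by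
    intro m s t hst
    simp only [ν, hVadd s t hst, map_add, Set.indicator_union_of_disjoint hst]
    ring
  have hνbd : ∀ m s, |ν m s| ≤ ‖S‖ + 1 := by
    intro m s
    refine (abs_sub _ _).trans (add_le_add ((hφ m _).trans ((S.le_opNorm _).trans ?_)) ?_)
    · exact mul_le_of_le_one_right (norm_nonneg _) (norm_indClass_le _)
    · by_cases h : m ∈ s <;> simp [h]
  have hνpt : ∀ m n, ν m {n} = 0 := by
    intro m n
    simp only [ν, V, Set.biUnion_singleton, hGB, hS, hφA]
    by_cases h : m = n <;> simp [h]
  obtain ⟨a, ha⟩ : ∃ a, ∀ m, ν m (A a) = 0 := by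
    have hcount : (⋃ m, {a | ν m (A a) ≠ 0}).Countable := Set.countable_iUnion fun m =>
      countable_ne_zero_of_additive hA (hνadd m) (hνbd m) (hνpt m)
    by_contra hcon
    push Not at hcon
    refine Set.not_countable_univ (α := ι) (hcount.mono fun a _ => ?_)
    obtain ⟨m, hm⟩ := hcon a
    exact Set.mem_iUnion.2 ⟨m, hm⟩
  obtain ⟨f', hf'⟩ := (czero ℕ).mkQ_surjective (S (indClass (C ∪ V (A a))))
  refine ⟨C ∪ V (A a), (hC.union hDc).mono fun j hj => ?_, f', hf', ?_⟩
  · by_contra hcon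
    simp only [Set.mem_union, Set.mem_ofPred_eq, not_or, Set.not_infinite] at hcon
    refine hj ((hcon.1.union hcon.2).subset ?_)
    rintro x ⟨hx, hx' | hx'⟩
    · exact Or.inl ⟨hx, hx'⟩
    · simp only [V, Set.mem_iUnion] at hx'
      obtain ⟨n, -, hxn⟩ := hx'
      exact Or.inr ⟨hx, hxn.1.1.2⟩
  · have hdisj : Disjoint C (V (A a)) := Set.disjoint_iUnion₂_right.2 fun n _ =>
      Set.disjoint_left.2 fun x hx hx' => hx'.1.2 hx
    refine ((hAinf a).image hi_inj.injOn).mono ?_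
    rintro _ ⟨m, hm, rfl⟩
    have hone : φ m (S (indClass (V (A a)))) = 1 := by
      have := ha m
      simp only [ν, Set.indicator_of_mem hm, Pi.one_apply, sub_eq_zero] at this
      exact this
    have hr : r ≤ φ m (S (indClass C)) := by
      rw [← hf]
      exact ge_of_tendsto (hφt m f) (mem_of_superset (hUA m) Set.inter_subset_right)
    have hlim := hφt m f'
    rw [hf', indClass_union hdisj, map_add, map_add, hone] at hlim
    -- The limit is at least `r + 1`; losing `1 / 2` makes the inequality hold pointwise.
    have hev : {n | r + 1 / 2 ≤ f' n} ∈ U m :=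
      (hlim.eventually (lt_mem_nhds (show r + 1 / 2 < _ by linarith))).mono fun n hn => hn.le
    exact infinite_of_mem_free_ultrafilter (hU m)
      (inter_mem (mem_of_superset (hUA m) Set.inter_subset_left) hev)

/-- No operator on `ℓ_∞/c₀` takes the members of a countably separated almost disjoint family to
those of a maximal one. -/
theorem not_exists_operator [Uncountable ι]
    (hA : ∀ i j, i ≠ j → (A i ∩ A j).Finite)
    (hmax : ∀ M : Set ℕ, M.Infinite → M ⊆ ⋃ i, A i → ∃ i, (M ∩ A i).Infinite)
    (hAinf : ∀ i, (A i).Infinite)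
    (hB : ∀ i j, i ≠ j → (B i ∩ B j).Finite)
    (hsep : ∀ J : Set ι, J.Countable →
      ∃ D : Set ℕ, (∀ j ∈ J, (B j \ D).Finite) ∧ {i | (B i ∩ D).Infinite}.Countable)
    (S : LInftyModCzero →L[ℝ] LInftyModCzero) :
    ¬ ∀ i, S (indClass (B i)) = indClass (A i) := by
  intro hS
  have key : ∀ k : ℕ, ∃ C : Set ℕ, {i | (B i ∩ C).Infinite}.Countable ∧ ∃ f : LInfty ℕ,
      (czero ℕ).mkQ f = S (indClass C) ∧
        {i | (A i ∩ {n | (k : ℝ) / 2 ≤ f n}).Infinite}.Infinite := by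
    intro k
    induction k with
    | zero =>
      refine ⟨∅, by simp, 0, ?_, ?_⟩
      · have : indClass ∅ = 0 := by
          simpa using indClass_union (Set.disjoint_empty ∅)
        rw [this, map_zero, map_zero]
      · have : {i | (A i ∩ {n | ((0 : ℕ) : ℝ) / 2 ≤ (0 : LInfty ℕ) n}).Infinite} = Set.univ := by
          simpa [Set.eq_univ_iff_forall] using hAinf
        rw [this]
        exact Set.infinite_univ
    | succ k ih =>
      obtain ⟨C, hC, f, hf, hfA⟩ := ih
      have := exists_set_operator_step hA hmax hAinf hB hsep S hS hC hf hfA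
      have hk : ((k + 1 : ℕ) : ℝ) / 2 = (k : ℝ) / 2 + 1 / 2 := by push_cast; ring
      rwa [hk]
  obtain ⟨k, hk⟩ := exists_nat_gt (2 * ‖S‖)
  obtain ⟨C, -, f, hf, hfA⟩ := key k
  obtain ⟨i, hi⟩ := hfA.nonempty
  obtain ⟨U, hU, hUm⟩ := exists_free_ultrafilter hi
  obtain ⟨φ, hφ, hφt⟩ := exists_functional_tendsto U hU
  have h1 : (k : ℝ) / 2 ≤ φ (S (indClass C)) := by
    rw [← hf]
    exact ge_of_tendsto (hφt f) (mem_of_superset hUm Set.inter_subset_right)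
  have h2 : φ (S (indClass C)) ≤ ‖S‖ := (le_abs_self _).trans ((hφ _).trans
    ((S.le_opNorm _).trans (mul_le_of_le_one_right (norm_nonneg _) (norm_indClass_le _))))
  linarith

end NoExtension

/-! ### The family and its permutation -/

theorem Set.Finite.image_inter_image {f : ℕ → ℕ} (hf : Function.Injective f) {s t : Set ℕ}
    (h : (s ∩ t).Finite) : (f '' s ∩ f '' t).Finite := by
  rw [← Set.image_inter hf]
  exact h.image f

/-- If `𝔞 = ω₁`, an almost disjoint family of size `ω₁` and a permutation of it that no operator on
`ℓ_∞/c₀` induces: a maximal family on the even numbers and a countably separated family on the odd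
numbers, interchanged by the permutation. -/
theorem exists_family_permutation {ι : Type} (h : almostDisjointnessNumber = ℵ_ 1)
    (hι : #ι = ℵ_ 1) :
    ∃ (F : ι → Set ℕ) (σ : Equiv.Perm ι), (∀ i, (F i).Infinite) ∧
      (∀ i j, i ≠ j → (F i ∩ F j).Finite) ∧
      ∀ S : LInftyModCzero →L[ℝ] LInftyModCzero,
        ¬ ∀ i, S (indClass (F i)) = indClass (F (σ i)) := by
  have : Uncountable ι := by
    rw [← Cardinal.aleph0_lt_mk_iff, hι]
    exact Cardinal.aleph0_lt_aleph_one
  obtain ⟨A, hAinf, hA, hmax⟩ := exists_maximal_family h hι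
  obtain ⟨B, hBinf, hB, hsep⟩ := exists_countably_separated_family hι
  have h0 : Function.Injective fun n : ℕ => 2 * n := fun a b hab => by
    simpa using hab
  have h1 : Function.Injective fun n : ℕ => 2 * n + 1 := fun a b hab => by
    simpa using hab
  let A' : ι → Set ℕ := fun i => (fun n => 2 * n) '' A i
  let B' : ι → Set ℕ := fun i => (fun n => 2 * n + 1) '' B i
  have hA' : ∀ i j, i ≠ j → (A' i ∩ A' j).Finite := fun i j hij =>
    (hA i j hij).image_inter_image h0
  have hB' : ∀ i j, i ≠ j → (B' i ∩ B' j).Finite := fun i j hij =>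
    (hB i j hij).image_inter_image h1
  have hAinf' : ∀ i, (A' i).Infinite := fun i => (hAinf i).image h0.injOn
  have hBinf' : ∀ i, (B' i).Infinite := fun i => (hBinf i).image h1.injOn
  have hAB : ∀ i j, A' i ∩ B' j = ∅ := by
    intro i j
    refine Set.eq_empty_of_forall_notMem ?_
    rintro _ ⟨⟨m, -, rfl⟩, ⟨n, -, hn⟩⟩
    simp only at hn
    omega
  have hmax' : ∀ M : Set ℕ, M.Infinite → M ⊆ ⋃ i, A' i → ∃ i, (M ∩ A' i).Infinite := by
    intro M hM hMA
    have hMr : M ⊆ Set.range fun n : ℕ => 2 * n := fun x hx => by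
      obtain ⟨i, n, -, rfl⟩ := Set.mem_iUnion.1 (hMA hx)
      exact ⟨n, rfl⟩
    obtain ⟨i, hi⟩ := hmax ((fun n => 2 * n) ⁻¹' M) (hM.preimage hMr)
    refine ⟨i, (hi.image h0.injOn).mono ?_⟩
    rintro _ ⟨n, ⟨hn, hn'⟩, rfl⟩
    exact ⟨hn, n, hn', rfl⟩
  have hsep' : ∀ J : Set ι, J.Countable →
      ∃ D : Set ℕ, (∀ j ∈ J, (B' j \ D).Finite) ∧ {i | (B' i ∩ D).Infinite}.Countable := by
    intro J hJ
    obtain ⟨D, hD, hDc⟩ := hsep J hJ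
    refine ⟨(fun n => 2 * n + 1) '' D, fun j hj => ?_, hDc.mono ?_⟩
    · rw [← Set.image_sdiff h1]
      exact (hD j hj).image _
    · exact fun i hi hfin => hi (hfin.image_inter_image h1)
  obtain ⟨e⟩ : Nonempty (ι ≃ ι ⊕ ι) := by
    rw [← Cardinal.eq, Cardinal.mk_sum, Cardinal.lift_id, hι,
      Cardinal.add_eq_self (Cardinal.aleph0_le_aleph 1)]
  refine ⟨fun i => Sum.elim A' B' (e i), (e.trans (Equiv.sumComm ι ι)).trans e.symm,
    fun i => ?_, fun i j hij => ?_, fun S hS => ?_⟩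
  · change (Sum.elim A' B' (e i)).Infinite
    rcases e i with a | a
    exacts [hAinf' a, hBinf' a]
  · have hne : e i ≠ e j := e.injective.ne hij
    change (Sum.elim A' B' (e i) ∩ Sum.elim A' B' (e j)).Finite
    revert hne
    rcases e i with a | a <;> rcases e j with b | b <;> intro hne
    · exact hA' a b fun hab => hne (by rw [hab])
    · simp [hAB]
    · simp [Set.inter_comm, hAB]
    · exact hB' a b fun hab => hne (by rw [hab])
  · refine not_exists_operator hA' hmax' hAinf' hB' hsep' S fun i => ?_
    simpa using hS (e.symm (Sum.inr i))

end

theorem theorem1p1 (h : almostDisjointnessNumber = ℵ_ 1) (ι : Type) (hι : #ι = ℵ_ 1) :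
    ¬ IsAutomorphicFor (czero ι) LInftyModCzero ∧
      ¬ IsExtensibleFor (czero ι) LInftyModCzero := by
  obtain ⟨F, σ, hinf, hF, hno⟩ := exists_family_permutation h hι
  have hinf' : ∀ i, ((F ∘ σ) i).Infinite := fun i => hinf (σ i)
  have hF' : ∀ i j, i ≠ j → ((F ∘ σ) i ∩ (F ∘ σ) j).Finite := fun i j hij =>
    hF _ _ (σ.injective.ne hij)
  let Φ := czeroEmbedding F hinf hF
  let Ψ := czeroEmbedding (F ∘ σ) hinf' hF'
  have hno' : ∀ S : LInftyModCzero →L[ℝ] LInftyModCzero, ¬ ∀ f, S (Φ f) = Ψ f := by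
    intro S hS
    refine hno S fun i => ?_
    obtain ⟨f, hf⟩ := exists_czeroEmbedding_eq_indClass i
    have := hS f
    rwa [hf F, hf (F ∘ σ)] at this
  have hrange := range_czeroEmbedding_comp hinf hF σ hinf' hF'
  let eΦ : czero ι ≃L[ℝ] LinearMap.range Φ.toLinearMap := Φ.equivRange.toContinuousLinearEquiv
  let eΨ : czero ι ≃L[ℝ] LinearMap.range Ψ.toLinearMap := Ψ.equivRange.toContinuousLinearEquiv
  constructor
  · intro haut
    obtain ⟨S, hS⟩ := haut _ _ ⟨eΦ.symm⟩ ⟨eΨ.symm⟩ (by rw [hrange]) (eΦ.symm.trans eΨ)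
    refine hno' S fun f => ?_
    have := hS (eΦ f)
    rw [ContinuousLinearEquiv.trans_apply, ContinuousLinearEquiv.symm_apply_apply] at this
    exact this
  · intro hext
    obtain ⟨S, hS⟩ := hext _ ⟨eΦ.symm⟩
      (Ψ.toContinuousLinearMap.comp (eΦ.symm : _ →L[ℝ] czero ι))
    refine hno' S fun f => ?_
    have := hS (eΦ f)
    rw [ContinuousLinearMap.comp_apply, ContinuousLinearEquiv.coe_coe,
      ContinuousLinearEquiv.symm_apply_apply] at this
    exact this
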